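/- For $x\in\mathbb R^3$ let $$j(x)=\begin{pmatrix}0&x_3&-x_2\\-x_3&0&x_1\\x_2&-x_1&0\end{pmatrix}\in\mathfrak{so}(3),$$ and for a unit vector $\mathbf n\in\mathbb R^3$ and $\alpha\in\mathbb R$ let $R(\mathbf n,\alpha):=\exp(\alpha\, j(\mathbf n))$ be the rotation by the angle $\alpha$ around the axis generated by $\mathbf n$ (with the orientation fixed by $j$). Then $R(\mathbf n,\alpha)$ is given by the Rodrigues formula $$R(\mathbf n,\alpha)=I+(\sin\alpha)\,j(\mathbf n)+(1-\cos\alpha)\,j(\mathbf n)^2 .$$ In spherical coordinates put $\mathbf n(\phi,\psi)=(\cos\psi\cos\phi,\ \cos\psi\sin\phi,\ \sin\psi)$. Let $$U=[0,2\pi)\times\left[-\tfrac{\pi}{2},\tfrac{\pi}{2}\right]\times[0,\pi],\qquad p:U\to \mathrm{SO}(3),\quad p(\phi,\psi,\alpha)=R(\mathbf n(\phi,\psi),\alpha),$$ be the polar chart of $\mathrm{SO}(3)$; here $p(U)=\mathrm{SO}(3)$ and $p$ is injective on the interior of $U$. Let $\mu_{\mathrm{SO}(3)}$ be the Haar probability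 measure of $\mathrm{SO}(3)$. In this chart $$p^*\mu_{\mathrm{SO}(3)}=\frac{1}{2\pi^2}\cos\psi\,\sin^2\!\left(\frac{\alpha}{2}\right)d\phi\,d\psi\,d\alpha\quad\text{on }U,$$ that is, for every Borel set $A\subseteq U$, $$\mu_{\mathrm{SO}(3)}(p(A))=\int_A\frac{1}{2\pi^2}\cos\psi\,\sin^2\!\left(\frac{\alpha}{2}\right)d\phi\,d\psi\,d\alpha ,$$ and $\mu_{\mathrm{SO}(3)}$ is the image under $p$ of the measure $\frac{1}{2\pi^2}\cos\psi\,\sin^2(\alpha/2)\,d\phi\,d\psi\,d\alpha$ on $U$. -/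

import Mathlib

open MeasureTheory Set

/-- The group `SO(3)` of real `3 × 3` matrices `Q` with `Q Qᵀ = I` and `det Q = 1`,
with the topology induced from the space of matrices. -/
abbrev SO3 : Type := Matrix.specialOrthogonalGroup (Fin 3) ℝ

theorem SO3.mem_iff (A : Matrix (Fin 3) (Fin 3) ℝ) :
    A ∈ Matrix.specialOrthogonalGroup (Fin 3) ℝ ↔ A * A.transpose = 1 ∧ A.det = 1 := by
  rw [Matrix.mem_specialOrthogonalGroup_iff, Matrix.mem_orthogonalGroup_iff]

instance SO3.instIsTopologicalGroup : IsTopologicalGroup SO3 where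
  continuous_mul := continuous_mul
  continuous_inv :=
    Continuous.subtype_mk (Continuous.matrix_transpose continuous_subtype_val) _

theorem SO3.isCompact_carrier :
    IsCompact (Matrix.specialOrthogonalGroup (Fin 3) ℝ : Set (Matrix (Fin 3) (Fin 3) ℝ)) := by
  have hbox : IsCompact (Set.pi Set.univ fun _ : Fin 3 => Set.pi Set.univ fun _ : Fin 3 =>
      Set.Icc (-1 : ℝ) 1) :=
    isCompact_univ_pi fun _ => isCompact_univ_pi fun _ => isCompact_Icc
  refine IsCompact.of_isClosed_subset (X := Matrix (Fin 3) (Fin 3) ℝ) hbox ?_ ?_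
  · have h : (Matrix.specialOrthogonalGroup (Fin 3) ℝ : Set (Matrix (Fin 3) (Fin 3) ℝ)) =
        {A | A * A.transpose = 1} ∩ {A | A.det = 1} := by
      ext A
      exact SO3.mem_iff A
    rw [h]
    exact (isClosed_eq (continuous_id.matrix_mul continuous_id.matrix_transpose)
      continuous_const).inter (isClosed_eq continuous_id.matrix_det continuous_const)
  · intro A hA i _ j _
    have h1 := congrFun (congrFun ((SO3.mem_iff A).1 hA).1 i) i
    simp only [Matrix.mul_apply, Matrix.transpose_apply, Matrix.one_apply_eq] at h1
    have h2 : A i j * A i j ≤ ∑ k, A i k * A i k :=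
      Finset.single_le_sum (f := fun k => A i k * A i k)
        (fun k _ => mul_self_nonneg _) (Finset.mem_univ j)
    constructor <;> nlinarith

instance SO3.instCompactSpace : CompactSpace SO3 :=
  isCompact_iff_compactSpace.1 SO3.isCompact_carrier

instance SO3.instMeasurableSpace : MeasurableSpace SO3 := borel SO3

instance SO3.instBorelSpace : BorelSpace SO3 := ⟨rfl⟩

/-- The Haar probability measure of the compact group `SO(3)`: the left-invariant Borel measure
of total mass one. -/
noncomputable def haarSO3 : Measure SO3 := Measure.haarMeasure ⊤

instance haarSO3.instIsProbabilityMeasure : IsProbabilityMeasure haarSO3 :=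
  ⟨Measure.haarMeasure_self⟩

instance haarSO3.instIsMulLeftInvariant : haarSO3.IsMulLeftInvariant :=
  Measure.isMulLeftInvariant_haarMeasure ⊤

/-- The isomorphism `j` from `ℝ³` onto the skew-symmetric matrices `𝔰𝔬(3)`. -/
def skewMatrix (x : Fin 3 → ℝ) : Matrix (Fin 3) (Fin 3) ℝ :=
  !![0, x 2, -x 1; -x 2, 0, x 0; x 1, -x 0, 0]

/-- The rotation `R(n, α) = exp (α j(n))` around the axis generated by `n`. -/
noncomputable def axisRotation (n : Fin 3 → ℝ) (α : ℝ) : Matrix (Fin 3) (Fin 3) ℝ :=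
  NormedSpace.exp (α • skewMatrix n)

theorem skewMatrix_transpose (x : Fin 3 → ℝ) : (skewMatrix x).transpose = -skewMatrix x := by
  ext i j
  fin_cases i <;> fin_cases j <;> simp [skewMatrix]

theorem axisRotation_mul_transpose (n : Fin 3 → ℝ) (α : ℝ) :
    axisRotation n α * (axisRotation n α).transpose = 1 := by
  unfold axisRotation
  rw [← Matrix.exp_transpose, Matrix.transpose_smul, skewMatrix_transpose, smul_neg,
    ← Matrix.exp_add_of_commute (α • skewMatrix n) (-(α • skewMatrix n))
      (Commute.refl (α • skewMatrix n)).neg_right, add_neg_cancel,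
    NormedSpace.exp_zero]

theorem axisRotation_half_sq (n : Fin 3 → ℝ) (α : ℝ) :
    axisRotation n (α / 2) * axisRotation n (α / 2) = axisRotation n α := by
  unfold axisRotation
  rw [← Matrix.exp_add_of_commute _ _ (Commute.refl _), ← add_smul, add_halves]

theorem axisRotation_mem (n : Fin 3 → ℝ) (α : ℝ) :
    axisRotation n α ∈ Matrix.specialOrthogonalGroup (Fin 3) ℝ := by
  refine (SO3.mem_iff _).2 ⟨axisRotation_mul_transpose n α, ?_⟩
  have h := congrArg Matrix.det (axisRotation_mul_transpose n (α / 2))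
  rw [Matrix.det_mul, Matrix.det_transpose, Matrix.det_one] at h
  rw [← axisRotation_half_sq, Matrix.det_mul, h]

/-- The unit vector `n(φ, ψ)` in spherical coordinates (longitude `φ`, latitude `ψ`). -/
noncomputable def sphericalAxis (φ ψ : ℝ) : Fin 3 → ℝ :=
  ![Real.cos ψ * Real.cos φ, Real.cos ψ * Real.sin φ, Real.sin ψ]

/-- The map `p : (φ, ψ, α) ↦ R(n(φ, ψ), α)` with values in `SO(3)`. -/
noncomputable def polarChart (u : ℝ × ℝ × ℝ) : SO3 :=
  ⟨axisRotation (sphericalAxis u.1 u.2.1) u.2.2, axisRotation_mem _ _⟩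

/-- The parameter domain `U = [0, 2π) × [-π/2, π/2] × [0, π]` of the triples `(φ, ψ, α)`. -/
def polarDomain : Set (ℝ × ℝ × ℝ) :=
  Ico 0 (2 * Real.pi) ×ˢ (Icc (-(Real.pi / 2)) (Real.pi / 2) ×ˢ Icc 0 Real.pi)

/-- The density `(1 / (2π²)) cos ψ sin² (α / 2)`. -/
noncomputable def polarDensity (u : ℝ × ℝ × ℝ) : ℝ :=
  1 / (2 * Real.pi ^ 2) * Real.cos u.2.1 * Real.sin (u.2.2 / 2) ^ 2

/-!
The Rodrigues formula holds because both sides solve the linear equation `X' = j(n) X`, since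
`j(n)³ = -j(n)` for a unit vector `n` (`axisRotation_eq_rodrigues`).

The remaining claims rest on the parametrisation of `SO(3)` by quaternions. The Euler–Rodrigues
matrix `eulerMatrix` is quadratic in the quaternion and multiplicative up to the order of the
factors; on the unit sphere it takes values in `SO(3)`, and it is onto because a quaternion of a
given rotation can be read off from the entries of the rotation (`SO3.exists_eulerMatrix`). The
rotation `R(n, α)` has the quaternion `cos (α / 2) + sin (α / 2) n`, so the polar chart is
obtained from spherical coordinates on the half sphere of unit quaternions with nonnegative real
part. This gives surjectivity of the chart; injectivity on the interior follows from the trace and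
the skew-symmetric part of the Rodrigues formula.

For the Haar measure, push Lebesgue measure on the unit ball of the quaternions forward to
`SO(3)`. A left translation of `SO(3)` lifts to multiplication by a unit quaternion, a linear map
that preserves the norm and hence the volume, so the image measure `quatMeasure` is left-invariant
and is a multiple of the Haar measure by uniqueness (`quatMeasure_eq_smul_haarSO3`). On the other
hand three successive passages to plane polar coordinates write Lebesgue measure on the
quaternions with positive real part, in the coordinates `r (cos (α / 2) + sin (α / 2) n(φ, ψ))`,
as `½ r³ sin² (α / 2) cos ψ dr dα dψ dφ` (`setLIntegral_quat_eq`); the other half contributes the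
same by the symmetry `q ↦ -q`. The radial factor splits off, so `quatMeasure` is also a multiple
of the image under the chart of the measure with the stated density
(`exists_quatMeasure_eq_smul`). That image and the Haar measure both have total mass one and
therefore agree (`map_polarMeasure_eq_haarSO3`). Since the boundary of the domain is null and no
interior point shares its rotation with another point of the domain, the formula for the measure
of `p(A)` follows (`haarSO3_polarChart_image`).
-/

/-! ### The Rodrigues formula -/

theorem skewMatrix_mul_sq (n : Fin 3 → ℝ) :
    skewMatrix n * skewMatrix n ^ 2 = -(n 0 ^ 2 + n 1 ^ 2 + n 2 ^ 2) • skewMatrix n := by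
  ext i j
  fin_cases i <;> fin_cases j <;>
    simp [skewMatrix, pow_two, Matrix.mul_apply, Fin.sum_univ_three] <;> ring

section

-- Differentiating `exp` needs a normed algebra; every norm on matrices induces the same topology.
attribute [local instance] Matrix.linftyOpNormedRing Matrix.linftyOpNormedAlgebra

/-- Both sides solve the linear differential equation `X' = j(n) X` with `X(0) = 1`: the product of
the right-hand side with `exp (-α j(n))` has derivative zero. -/
theorem axisRotation_eq_rodrigues (n : Fin 3 → ℝ) (hn : n 0 ^ 2 + n 1 ^ 2 + n 2 ^ 2 = 1) (α : ℝ) :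
    axisRotation n α = 1 + Real.sin α • skewMatrix n + (1 - Real.cos α) • skewMatrix n ^ 2 := by
  set J := skewMatrix n with hJ
  have hJ3 : J * J ^ 2 = -J := by rw [hJ, skewMatrix_mul_sq, hn, neg_one_smul]
  let R : ℝ → Matrix (Fin 3) (Fin 3) ℝ := fun a => 1 + Real.sin a • J + (1 - Real.cos a) • J ^ 2
  have hR : ∀ a, HasDerivAt R (J * R a) a := by
    intro a
    have h1 : HasDerivAt R (Real.cos a • J + Real.sin a • J ^ 2) a := by
      have hs := (Real.hasDerivAt_sin a).smul_const J
      have hc := ((Real.hasDerivAt_cos a).const_sub 1).smul_const (J ^ 2)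
      rw [neg_neg] at hc
      exact (hs.const_add 1).add hc
    convert h1 using 1
    simp only [R, mul_add, mul_one, Matrix.mul_smul, hJ3, ← pow_two]
    module
  have hE : ∀ a : ℝ, HasDerivAt (fun u : ℝ => NormedSpace.exp (u • -J))
      (NormedSpace.exp (a • -J) * -J) a := fun a => hasDerivAt_exp_smul_const (-J) a
  have hprod : ∀ a, HasDerivAt (fun u : ℝ => NormedSpace.exp (u • -J) * R u) 0 a := by
    intro a
    have h := (hE a).mul (hR a)
    have h0 : NormedSpace.exp (a • -J) * -J * R a + NormedSpace.exp (a • -J) * (J * R a) = 0 := by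
      rw [mul_neg, neg_mul, mul_assoc, neg_add_cancel]
    rw [h0] at h
    exact h
  have hconst : NormedSpace.exp (α • -J) * R α = 1 := by
    have h := is_const_of_deriv_eq_zero (fun a => (hprod a).differentiableAt)
      (fun a => (hprod a).deriv) α 0
    simpa [R] using h
  have hinv : axisRotation n α * NormedSpace.exp (α • -J) = 1 := by
    rw [axisRotation, ← hJ, smul_neg, ← Matrix.exp_add_of_commute (α • J) (-(α • J))
      (Commute.refl (α • J)).neg_right, add_neg_cancel, NormedSpace.exp_zero]
  calc axisRotation n α = axisRotation n α * (NormedSpace.exp (α • -J) * R α) := by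
        rw [hconst, mul_one]
    _ = R α := by rw [← mul_assoc, hinv, one_mul]

end

theorem sphericalAxis_normSq (φ ψ : ℝ) :
    sphericalAxis φ ψ 0 ^ 2 + sphericalAxis φ ψ 1 ^ 2 + sphericalAxis φ ψ 2 ^ 2 = 1 := by
  simp only [sphericalAxis, Matrix.cons_val_zero, Matrix.cons_val_one, Matrix.cons_val]
  linear_combination Real.cos ψ ^ 2 * Real.sin_sq_add_cos_sq φ + Real.sin_sq_add_cos_sq ψ

/-! ### The quaternion parametrisation of `SO(3)` -/

/-- The Euler–Rodrigues matrix of the quaternion `w + x i + y j + z k`, which is the square of the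
norm times a rotation. It equals `(w² - |v|²) I + 2 w j(v) + 2 v vᵀ` with `v = (x, y, z)`. -/
def eulerMatrix (w x y z : ℝ) : Matrix (Fin 3) (Fin 3) ℝ :=
  !![w ^ 2 + x ^ 2 - y ^ 2 - z ^ 2, 2 * (x * y + w * z), 2 * (x * z - w * y);
     2 * (x * y - w * z), w ^ 2 - x ^ 2 + y ^ 2 - z ^ 2, 2 * (y * z + w * x);
     2 * (x * z + w * y), 2 * (y * z - w * x), w ^ 2 - x ^ 2 - y ^ 2 + z ^ 2]

theorem eulerMatrix_mul_transpose (w x y z : ℝ) :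
    eulerMatrix w x y z * (eulerMatrix w x y z).transpose =
      (w ^ 2 + x ^ 2 + y ^ 2 + z ^ 2) ^ 2 • (1 : Matrix (Fin 3) (Fin 3) ℝ) := by
  ext i j
  fin_cases i <;> fin_cases j <;>
    simp [eulerMatrix, Matrix.mul_apply, Fin.sum_univ_three] <;> ring

theorem eulerMatrix_det (w x y z : ℝ) :
    (eulerMatrix w x y z).det = (w ^ 2 + x ^ 2 + y ^ 2 + z ^ 2) ^ 3 := by
  simp only [eulerMatrix, Matrix.det_fin_three, Matrix.of_apply, Matrix.cons_val',
    Matrix.cons_val_zero, Matrix.cons_val_one, Matrix.cons_val]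
  ring

/-- The orientation chosen in `skewMatrix` makes the Euler–Rodrigues map an anti-homomorphism on
Hamilton's quaternions, so the product on the right is the opposite quaternion product. -/
theorem eulerMatrix_mul (a b c d w x y z : ℝ) :
    eulerMatrix a b c d * eulerMatrix w x y z =
      eulerMatrix (a * w - b * x - c * y - d * z) (a * x + b * w - c * z + d * y)
        (a * y + c * w - d * x + b * z) (a * z + d * w - b * y + c * x) := by
  ext i j
  fin_cases i <;> fin_cases j <;>
    simp [eulerMatrix, Matrix.mul_apply, Fin.sum_univ_three] <;> ring

theorem eulerMatrix_smul (r w x y z : ℝ) :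
    eulerMatrix (r * w) (r * x) (r * y) (r * z) = r ^ 2 • eulerMatrix w x y z := by
  ext i j
  fin_cases i <;> fin_cases j <;> simp [eulerMatrix] <;> ring

theorem eulerMatrix_neg (w x y z : ℝ) :
    eulerMatrix (-w) (-x) (-y) (-z) = eulerMatrix w x y z := by
  ext i j
  fin_cases i <;> fin_cases j <;> simp [eulerMatrix]

/-- The rotation by `α` around `n` corresponds to the quaternion `cos (α / 2) + sin (α / 2) n`. -/
theorem axisRotation_eq_eulerMatrix (n : Fin 3 → ℝ) (hn : n 0 ^ 2 + n 1 ^ 2 + n 2 ^ 2 = 1)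
    (α : ℝ) :
    axisRotation n α = eulerMatrix (Real.cos (α / 2)) (Real.sin (α / 2) * n 0)
      (Real.sin (α / 2) * n 1) (Real.sin (α / 2) * n 2) := by
  have hc : Real.cos α = 1 - 2 * Real.sin (α / 2) ^ 2 := by
    rw [← Real.cos_two_mul_eq_one_sub]; congr 1; ring
  have hs : Real.sin α = 2 * Real.sin (α / 2) * Real.cos (α / 2) := by
    rw [← Real.sin_two_mul]; congr 1; ring
  have hsc : Real.cos (α / 2) ^ 2 = 1 - Real.sin (α / 2) ^ 2 := by
    rw [← Real.sin_sq_add_cos_sq (α / 2)]; ring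
  have h0 : n 2 ^ 2 = 1 - n 0 ^ 2 - n 1 ^ 2 := by linarith
  rw [axisRotation_eq_rodrigues n hn, hc, hs]
  ext i j
  fin_cases i <;> fin_cases j <;>
    simp [eulerMatrix, skewMatrix, pow_two (!![_, _, _; _, _, _; _, _, _] : Matrix _ _ ℝ),
      mul_pow, hsc, h0] <;> ring_nf <;> (try simp only [h0]) <;> ring

/-- The quadratic relations between the entries of a matrix of `SO(3)`: orthonormality of the rows
and of the columns, and equality of the matrix with its cofactor matrix. -/
theorem SO3.entry_relations {A : Matrix (Fin 3) (Fin 3) ℝ}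
    (hA : A ∈ Matrix.specialOrthogonalGroup (Fin 3) ℝ) :
    A * A.transpose = 1 ∧ A.transpose * A = 1 ∧ A.adjugate = A.transpose := by
  obtain ⟨h1, h2⟩ := (SO3.mem_iff A).1 hA
  have h3 : A.transpose * A = 1 := mul_eq_one_comm.1 h1
  refine ⟨h1, h3, ?_⟩
  have h := congrArg (A.transpose * ·) A.mul_adjugate
  simpa only [← mul_assoc, h3, h2, one_mul, one_smul, mul_one] using h

/-- For a rotation `A` with unit quaternion `q`, the matrix `4 q qᵀ` has entries affine in those of
`A`. Its rows are multiples of `q`, hence have Euler–Rodrigues matrices proportional to `A`; the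
factor is four times the diagonal entry of the row. All these identities are linear consequences of
the quadratic relations between the entries of `A`. -/
theorem SO3.eulerMatrix_davenport {A : Matrix (Fin 3) (Fin 3) ℝ}
    (hA : A ∈ Matrix.specialOrthogonalGroup (Fin 3) ℝ) :
    eulerMatrix (1 + A 0 0 + A 1 1 + A 2 2) (A 1 2 - A 2 1) (A 2 0 - A 0 2) (A 0 1 - A 1 0) =
      (4 * (1 + A 0 0 + A 1 1 + A 2 2)) • A ∧
    eulerMatrix (A 1 2 - A 2 1) (1 + A 0 0 - A 1 1 - A 2 2) (A 0 1 + A 1 0) (A 0 2 + A 2 0) =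
      (4 * (1 + A 0 0 - A 1 1 - A 2 2)) • A ∧
    eulerMatrix (A 2 0 - A 0 2) (A 0 1 + A 1 0) (1 - A 0 0 + A 1 1 - A 2 2) (A 1 2 + A 2 1) =
      (4 * (1 - A 0 0 + A 1 1 - A 2 2)) • A ∧
    eulerMatrix (A 0 1 - A 1 0) (A 0 2 + A 2 0) (A 1 2 + A 2 1) (1 - A 0 0 - A 1 1 + A 2 2) =
      (4 * (1 - A 0 0 - A 1 1 + A 2 2)) • A := by
  obtain ⟨h1, h2, h3⟩ := SO3.entry_relations hA
  obtain ⟨a, b, c, d, e, f, g, h, i, rfl⟩ : ∃ a b c d e f g h i : ℝ,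
    A = !![a, b, c; d, e, f; g, h, i] := ⟨_, _, _, _, _, _, _, _, _, A.eta_fin_three⟩
  have e1 := fun i j => congrFun (congrFun h1 i) j
  have e2 := fun i j => congrFun (congrFun h2 i) j
  have e3 := fun i j => congrFun (congrFun h3 i) j
  simp [Matrix.adjugate_fin_three, Matrix.mul_apply, Fin.sum_univ_three,
    Fin.forall_fin_succ] at e1 e2 e3
  obtain ⟨⟨r1, r2, r3⟩, ⟨-, r4, r5⟩, -, -, r6⟩ := e1
  obtain ⟨⟨c1, c2, c3⟩, ⟨-, c4, c5⟩, -, -, c6⟩ := e2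
  obtain ⟨⟨k1, k2, k3⟩, ⟨k4, k5, k6⟩, k7, k8, k9⟩ := e3
  clear h1 h2 h3 hA
  refine ⟨?_, ?_, ?_, ?_⟩ <;> ext i j <;> fin_cases i <;> fin_cases j <;>
    simp [eulerMatrix] <;> linarith

theorem SO3.exists_eulerMatrix {A : Matrix (Fin 3) (Fin 3) ℝ}
    (hA : A ∈ Matrix.specialOrthogonalGroup (Fin 3) ℝ) :
    ∃ w x y z : ℝ, w ^ 2 + x ^ 2 + y ^ 2 + z ^ 2 = 1 ∧ 0 ≤ w ∧ A = eulerMatrix w x y z := by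
  -- It suffices to find a quaternion whose Euler–Rodrigues matrix is a positive multiple of `A`:
  -- its norm is then determined by the determinant, and its sign is at choice.
  suffices H : ∃ w x y z t : ℝ, 0 < t ∧ eulerMatrix w x y z = t • A by
    obtain ⟨w, x, y, z, t, ht, h⟩ := H
    have hdet := congrArg Matrix.det h
    rw [eulerMatrix_det, Matrix.det_smul, ((SO3.mem_iff A).1 hA).2, Fintype.card_fin, mul_one,
      pow_left_inj₀ (by positivity) ht.le (by norm_num)] at hdet
    have hst : (√t)⁻¹ ^ 2 = t⁻¹ := by rw [inv_pow, Real.sq_sqrt ht.le]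
    have hA' : A = eulerMatrix ((√t)⁻¹ * w) ((√t)⁻¹ * x) ((√t)⁻¹ * y) ((√t)⁻¹ * z) := by
      rw [eulerMatrix_smul, h, hst, inv_smul_smul₀ ht.ne']
    have hN : ((√t)⁻¹ * w) ^ 2 + ((√t)⁻¹ * x) ^ 2 + ((√t)⁻¹ * y) ^ 2 + ((√t)⁻¹ * z) ^ 2 = 1 := by
      simp only [mul_pow, hst, ← mul_add, hdet]
      exact inv_mul_cancel₀ ht.ne'
    rcases le_total 0 ((√t)⁻¹ * w) with hw | hw
    · exact ⟨_, _, _, _, hN, hw, hA'⟩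
    · refine ⟨_, _, _, _, ?_, neg_nonneg.2 hw, hA'.trans (eulerMatrix_neg _ _ _ _).symm⟩
      simpa only [neg_sq] using hN
  obtain ⟨h0, h1, h2, h3⟩ := SO3.eulerMatrix_davenport hA
  by_cases p0 : 0 < 1 + A 0 0 + A 1 1 + A 2 2
  · exact ⟨_, _, _, _, _, by positivity, h0⟩
  by_cases p1 : 0 < 1 + A 0 0 - A 1 1 - A 2 2
  · exact ⟨_, _, _, _, _, by positivity, h1⟩
  by_cases p2 : 0 < 1 - A 0 0 + A 1 1 - A 2 2
  · exact ⟨_, _, _, _, _, by positivity, h2⟩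
  -- the four diagonal entries of `4 q qᵀ` add up to `4`
  have p3 : 0 < 1 - A 0 0 - A 1 1 + A 2 2 := by linarith
  exact ⟨_, _, _, _, _, by positivity, h3⟩

/-! ### The polar chart is onto, and injective on the interior of its domain -/

theorem polarChart_eq_rodrigues (φ ψ α : ℝ) :
    (polarChart (φ, ψ, α) : Matrix (Fin 3) (Fin 3) ℝ) =
      1 + Real.sin α • skewMatrix (sphericalAxis φ ψ) +
        (1 - Real.cos α) • skewMatrix (sphericalAxis φ ψ) ^ 2 :=
  axisRotation_eq_rodrigues _ (sphericalAxis_normSq φ ψ) α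

theorem polarChart_eq_eulerMatrix (φ ψ α : ℝ) :
    (polarChart (φ, ψ, α) : Matrix (Fin 3) (Fin 3) ℝ) =
      eulerMatrix (Real.cos (α / 2)) (Real.sin (α / 2) * (Real.cos ψ * Real.cos φ))
        (Real.sin (α / 2) * (Real.cos ψ * Real.sin φ)) (Real.sin (α / 2) * Real.sin ψ) :=
  axisRotation_eq_eulerMatrix _ (sphericalAxis_normSq φ ψ) α

theorem exists_polar (x y : ℝ) :
    ∃ r θ : ℝ, 0 ≤ r ∧ r ^ 2 = x ^ 2 + y ^ 2 ∧ θ ∈ Ioc (-Real.pi) Real.pi ∧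
      x = r * Real.cos θ ∧ y = r * Real.sin θ ∧
      (0 ≤ x → |θ| ≤ Real.pi / 2) ∧ (0 ≤ y → 0 ≤ θ) := by
  refine ⟨‖(⟨x, y⟩ : ℂ)‖, Complex.arg ⟨x, y⟩, norm_nonneg _, ?_, Complex.arg_mem_Ioc _,
    (Complex.norm_mul_cos_arg ⟨x, y⟩).symm, (Complex.norm_mul_sin_arg ⟨x, y⟩).symm,
    fun h => Complex.abs_arg_le_pi_div_two_iff.2 h, fun h => Complex.arg_nonneg_iff.2 h⟩
  rw [← Complex.normSq_eq_norm_sq, Complex.normSq_apply]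
  ring

theorem polarChart_image_polarDomain : polarChart '' polarDomain = univ := by
  refine eq_univ_of_forall fun A => ?_
  obtain ⟨w, x, y, z, hN, hw, hA⟩ := SO3.exists_eulerMatrix A.2
  obtain ⟨ρ, φ₀, hρ, hρ2, hφ₀, hx, hy, -, -⟩ := exists_polar x y
  obtain ⟨s, ψ, hs, hs2, -, hρs, hzs, hψ, -⟩ := exists_polar ρ z
  obtain ⟨r, β, hr, hr2, -, hwr, hsr, hβ, hβ0⟩ := exists_polar w s
  have hr1 : r = 1 := by
    rw [← pow_left_inj₀ hr zero_le_one two_ne_zero]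
    linarith
  subst hr1
  rw [one_mul] at hwr hsr
  -- the longitude is normalised to `[0, 2π)`
  obtain ⟨φ, hφ, hc, hs'⟩ : ∃ φ ∈ Ico 0 (2 * Real.pi),
      Real.cos φ = Real.cos φ₀ ∧ Real.sin φ = Real.sin φ₀ := by
    have hpi := Real.pi_pos
    rcases le_or_gt 0 φ₀ with h | h
    · exact ⟨φ₀, ⟨h, by linarith [hφ₀.2]⟩, rfl, rfl⟩
    · exact ⟨φ₀ + 2 * Real.pi, ⟨by linarith [hφ₀.1], by linarith⟩, Real.cos_add_two_pi _,
        Real.sin_add_two_pi _⟩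
  have hb := abs_le.1 (hβ hw)
  refine ⟨(φ, ψ, 2 * β), ⟨hφ, abs_le.1 (hψ hρ), by linarith [hβ0 hs], by linarith⟩, ?_⟩
  apply Subtype.ext
  rw [polarChart_eq_eulerMatrix, hA, mul_div_cancel_left₀ β two_ne_zero, ← hwr, ← hsr, hc, hs', hx,
    hy, hρs, hzs]
  congr 1 <;> ring

theorem interior_polarDomain : interior polarDomain =
    Ioo 0 (2 * Real.pi) ×ˢ (Ioo (-(Real.pi / 2)) (Real.pi / 2) ×ˢ Ioo 0 Real.pi) := by
  rw [polarDomain, interior_prod_eq, interior_prod_eq, interior_Ico, interior_Icc, interior_Icc]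

theorem skewMatrix_sq_apply (n : Fin 3 → ℝ) (i j : Fin 3) :
    (skewMatrix n ^ 2) i j =
      n i * n j - if i = j then n 0 ^ 2 + n 1 ^ 2 + n 2 ^ 2 else 0 := by
  fin_cases i <;> fin_cases j <;>
    simp [skewMatrix, pow_two, Matrix.mul_apply, Fin.sum_univ_three] <;> ring

/-- The trace of a rotation determines its angle, and its skew-symmetric part the axis, so a point
of the interior shares its rotation with no other point of the domain. -/
theorem polarChart_eq_of_mem_interior {u v : ℝ × ℝ × ℝ} (hu : u ∈ interior polarDomain)
    (hv : v ∈ polarDomain) (h : polarChart u = polarChart v) : u = v := by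
  rw [interior_polarDomain] at hu
  obtain ⟨φ, ψ, α⟩ := u
  obtain ⟨φ', ψ', α'⟩ := v
  obtain ⟨hφ, hψ, hα⟩ := hu
  obtain ⟨hφ', hψ', hα'⟩ := hv
  have hM := congrArg (Subtype.val : SO3 → Matrix (Fin 3) (Fin 3) ℝ) h
  rw [polarChart_eq_rodrigues, polarChart_eq_rodrigues] at hM
  have e := fun i j => congrFun (congrFun hM i) j
  simp only [Matrix.add_apply, Matrix.smul_apply, skewMatrix_sq_apply, sphericalAxis_normSq,
    smul_eq_mul] at e
  have hcos : Real.cos α = Real.cos α' := by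
    have h0 := e 0 0
    have h1 := e 1 1
    have h2 := e 2 2
    have hn := sphericalAxis_normSq φ ψ
    have hn' := sphericalAxis_normSq φ' ψ'
    simp [skewMatrix] at h0 h1 h2
    linear_combination 1 / 2 * (h0 + h1 + h2) - (1 - Real.cos α) / 2 * hn
      + (1 - Real.cos α') / 2 * hn'
  obtain rfl : α = α' := Real.injOn_cos (Ioo_subset_Icc_self hα) hα' hcos
  have hsin : Real.sin α ≠ 0 := (Real.sin_pos_of_mem_Ioo hα).ne'
  have hz : Real.sin ψ = Real.sin ψ' := by
    have h0 := e 0 1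
    have h1 := e 1 0
    simp [skewMatrix, sphericalAxis] at h0 h1
    apply mul_left_cancel₀ hsin
    linear_combination (h0 - h1) / 2
  obtain rfl : ψ = ψ' := Real.injOn_sin (Ioo_subset_Icc_self hψ) hψ' hz
  have hcψ : Real.cos ψ ≠ 0 := (Real.cos_pos_of_mem_Ioo hψ).ne'
  have hx : Real.cos φ = Real.cos φ' := by
    have h0 := e 1 2
    have h1 := e 2 1
    simp [skewMatrix, sphericalAxis] at h0 h1
    apply mul_left_cancel₀ (mul_ne_zero hsin hcψ)
    linear_combination (h0 - h1) / 2
  have hy : Real.sin φ = Real.sin φ' := by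
    have h0 := e 2 0
    have h1 := e 0 2
    simp [skewMatrix, sphericalAxis] at h0 h1
    apply mul_left_cancel₀ (mul_ne_zero hsin hcψ)
    linear_combination (h0 - h1) / 2
  have hφφ : Real.cos (φ - φ') = 1 := by
    rw [Real.cos_sub, hx, hy, ← Real.sin_sq_add_cos_sq φ']
    ring
  rw [Real.cos_eq_one_iff_of_lt_of_lt (by linarith [hφ.1, hφ'.2]) (by linarith [hφ.2, hφ'.1]),
    sub_eq_zero] at hφφ
  rw [hφφ]

theorem polarChart_injOn_interior : InjOn polarChart (interior polarDomain) :=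
  fun _ hu _ hv h => polarChart_eq_of_mem_interior hu (interior_subset hv) h

theorem continuous_polarChart : Continuous polarChart := by
  refine Continuous.subtype_mk (f := fun u : ℝ × ℝ × ℝ =>
    axisRotation (sphericalAxis u.1 u.2.1) u.2.2) ?_ _
  have h : (fun u : ℝ × ℝ × ℝ => axisRotation (sphericalAxis u.1 u.2.1) u.2.2) = fun u =>
      eulerMatrix (Real.cos (u.2.2 / 2)) (Real.sin (u.2.2 / 2) * (Real.cos u.2.1 * Real.cos u.1))
        (Real.sin (u.2.2 / 2) * (Real.cos u.2.1 * Real.sin u.1))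
        (Real.sin (u.2.2 / 2) * Real.sin u.2.1) :=
    funext fun u => axisRotation_eq_eulerMatrix _ (sphericalAxis_normSq _ _) _
  rw [h]
  refine continuous_matrix fun i j => ?_
  fin_cases i <;> fin_cases j <;> simp [eulerMatrix] <;> fun_prop

/-! ### An invariant measure on `SO(3)` from Lebesgue measure on the quaternions -/

/-- The squared norm of the quaternion `w + x i + y j + z k`, encoded as `(w, z, x, y)`: in this
order, spherical coordinates are reached by passing to plane polar coordinates first in the last two
entries, then in the entry before them, and finally in the first entry. -/
def quatNormSq (q : ℝ × ℝ × ℝ × ℝ) : ℝ := q.1 ^ 2 + q.2.2.1 ^ 2 + q.2.2.2 ^ 2 + q.2.1 ^ 2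

/-- The Euler–Rodrigues matrix of the quaternion encoded by `(w, z, x, y)`. -/
def quatMatrix (q : ℝ × ℝ × ℝ × ℝ) : Matrix (Fin 3) (Fin 3) ℝ :=
  eulerMatrix q.1 q.2.2.1 q.2.2.2 q.2.1

theorem quatNormSq_eq_zero {q : ℝ × ℝ × ℝ × ℝ} : quatNormSq q = 0 ↔ q = 0 := by
  constructor
  · intro h
    unfold quatNormSq at h
    ext <;> simp only [Prod.fst_zero, Prod.snd_zero] <;> nlinarith
  · rintro rfl
    simp [quatNormSq]

theorem continuous_quatNormSq : Continuous quatNormSq := by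
  unfold quatNormSq; fun_prop

theorem continuous_quatMatrix : Continuous quatMatrix := by
  refine continuous_matrix fun i j => ?_
  fin_cases i <;> fin_cases j <;> simp [quatMatrix, eulerMatrix] <;> fun_prop

theorem inv_quatNormSq_smul_mem {q : ℝ × ℝ × ℝ × ℝ} (hq : q ≠ 0) :
    (quatNormSq q)⁻¹ • quatMatrix q ∈ Matrix.specialOrthogonalGroup (Fin 3) ℝ := by
  have h0 : quatNormSq q ≠ 0 := fun h => hq (quatNormSq_eq_zero.1 h)
  refine (SO3.mem_iff _).2 ⟨?_, ?_⟩
  · rw [Matrix.transpose_smul, Matrix.smul_mul, Matrix.mul_smul, quatMatrix,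
      eulerMatrix_mul_transpose, ← quatNormSq, smul_smul, smul_smul]
    have : (quatNormSq q)⁻¹ * (quatNormSq q)⁻¹ * quatNormSq q ^ 2 = 1 := by field_simp
    rw [this, one_smul]
  · rw [Matrix.det_smul, quatMatrix, eulerMatrix_det, ← quatNormSq, Fintype.card_fin, ← mul_pow,
      inv_mul_cancel₀ h0, one_pow]

open Classical in
/-- The rotation of a quaternion, with the value `1` at the quaternion `0`. -/
noncomputable def quatRotation (q : ℝ × ℝ × ℝ × ℝ) : SO3 :=
  if h : q = 0 then 1 else ⟨(quatNormSq q)⁻¹ • quatMatrix q, inv_quatNormSq_smul_mem h⟩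

theorem quatRotation_coe {q : ℝ × ℝ × ℝ × ℝ} (hq : q ≠ 0) :
    (quatRotation q : Matrix (Fin 3) (Fin 3) ℝ) = (quatNormSq q)⁻¹ • quatMatrix q := by
  rw [quatRotation, dif_neg hq]

theorem measurable_quatRotation : Measurable quatRotation := by
  refine measurable_of_continuousOn_compl_singleton 0 ?_
  rw [Topology.IsInducing.subtypeVal.continuousOn_iff]
  refine ContinuousOn.congr (f := fun q => (quatNormSq q)⁻¹ • quatMatrix q) ?_
    fun q hq => quatRotation_coe hq
  have h0 : ∀ q ∈ ({0}ᶜ : Set (ℝ × ℝ × ℝ × ℝ)), quatNormSq q ≠ 0 :=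
    fun q hq h => hq (quatNormSq_eq_zero.1 h)
  exact (continuous_quatNormSq.continuousOn.inv₀ h0).smul continuous_quatMatrix.continuousOn

/-- Multiplication by the quaternion `p`, on the side that corresponds to left multiplication of
Euler–Rodrigues matrices. -/
def quatMul (p : ℝ × ℝ × ℝ × ℝ) : (ℝ × ℝ × ℝ × ℝ) →ₗ[ℝ] (ℝ × ℝ × ℝ × ℝ) where
  toFun q :=
    (p.1 * q.1 - p.2.2.1 * q.2.2.1 - p.2.2.2 * q.2.2.2 - p.2.1 * q.2.1,
     p.1 * q.2.1 + p.2.1 * q.1 - p.2.2.1 * q.2.2.2 + p.2.2.2 * q.2.2.1,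
     p.1 * q.2.2.1 + p.2.2.1 * q.1 - p.2.2.2 * q.2.1 + p.2.1 * q.2.2.2,
     p.1 * q.2.2.2 + p.2.2.2 * q.1 - p.2.1 * q.2.2.1 + p.2.2.1 * q.2.1)
  map_add' q q' := by
    ext <;> simp only [Prod.fst_add, Prod.snd_add] <;> ring
  map_smul' c q := by
    ext <;> simp only [Prod.smul_fst, Prod.smul_snd, smul_eq_mul, RingHom.id_apply] <;> ring

theorem quatMatrix_quatMul (p q : ℝ × ℝ × ℝ × ℝ) :
    quatMatrix (quatMul p q) = quatMatrix p * quatMatrix q :=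
  (eulerMatrix_mul _ _ _ _ _ _ _ _).symm

theorem quatNormSq_quatMul (p q : ℝ × ℝ × ℝ × ℝ) :
    quatNormSq (quatMul p q) = quatNormSq p * quatNormSq q := by
  simp only [quatNormSq, quatMul, LinearMap.coe_mk, AddHom.coe_mk]
  ring

/-- The open unit ball of the quaternions. -/
def quatBall : Set (ℝ × ℝ × ℝ × ℝ) := {q | quatNormSq q < 1}

theorem isOpen_quatBall : IsOpen quatBall := isOpen_lt continuous_quatNormSq continuous_const

theorem volume_quatBall_ne_zero : volume quatBall ≠ 0 :=
  (isOpen_quatBall.measure_pos volume ⟨0, by simp [quatBall, quatNormSq]⟩).ne'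

theorem volume_quatBall_ne_top : volume quatBall ≠ ⊤ := by
  refine (Metric.isBounded_closedBall (x := (0 : ℝ × ℝ × ℝ × ℝ)) (r := 1) |>.subset
    ?_).measure_lt_top.ne
  intro q hq
  have hq' : q.1 ^ 2 + q.2.2.1 ^ 2 + q.2.2.2 ^ 2 + q.2.1 ^ 2 < 1 := hq
  simp only [mem_closedBall_zero_iff, Prod.norm_def, Real.norm_eq_abs, max_le_iff]
  refine ⟨?_, ?_, ?_, ?_⟩ <;> refine abs_le_of_sq_le_sq (by nlinarith) zero_le_one

instance instIsAddHaarMeasureVolumeProdProd :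
    (volume : Measure (ℝ × ℝ × ℝ)).IsAddHaarMeasure := by
  have h : (volume : Measure (ℝ × ℝ)).IsAddHaarMeasure :=
    Measure.prod.instIsAddHaarMeasure volume volume
  exact Measure.prod.instIsAddHaarMeasure volume volume

instance instIsAddHaarMeasureVolumeProdProdProd :
    (volume : Measure (ℝ × ℝ × ℝ × ℝ)).IsAddHaarMeasure :=
  Measure.prod.instIsAddHaarMeasure volume volume

/-- A linear map that preserves a set of finite positive volume preserves the volume. -/
theorem measurePreserving_quatMul {p : ℝ × ℝ × ℝ × ℝ} (hp : quatNormSq p = 1) :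
    MeasurePreserving (quatMul p) volume volume := by
  have hN : ∀ q, quatNormSq (quatMul p q) = quatNormSq q := fun q => by
    rw [quatNormSq_quatMul, hp, one_mul]
  have hinj : Function.Injective (quatMul p) := by
    rw [injective_iff_map_eq_zero]
    intro q hq
    rw [← quatNormSq_eq_zero, ← hN, hq, quatNormSq_eq_zero]
  have hdet : LinearMap.det (quatMul p) ≠ 0 :=
    (LinearMap.isUnit_iff_isUnit_det _).1 ((Module.End.isUnit_iff _).2
      ⟨hinj, LinearMap.injective_iff_surjective.1 hinj⟩) |>.ne_zero
  have hball : quatMul p ⁻¹' quatBall = quatBall := by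
    ext q
    simp only [mem_preimage, quatBall, mem_ofPred_eq, hN]
  have h1 : ENNReal.ofReal |(LinearMap.det (quatMul p))⁻¹| = 1 := by
    have h := Measure.addHaar_preimage_linearMap volume hdet quatBall
    rw [hball] at h
    exact (ENNReal.mul_eq_right volume_quatBall_ne_zero volume_quatBall_ne_top).1 h.symm
  refine ⟨(LinearMap.continuous_of_finiteDimensional _).measurable, Measure.ext fun s hs => ?_⟩
  rw [Measure.map_apply (LinearMap.continuous_of_finiteDimensional _).measurable hs,
    Measure.addHaar_preimage_linearMap volume hdet, h1, one_mul]

/-- The image on `SO(3)` of Lebesgue measure on the unit ball of the quaternions. -/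
noncomputable def quatMeasure : Measure SO3 := (volume.restrict quatBall).map quatRotation

instance quatMeasure.instIsFiniteMeasure : IsFiniteMeasure quatMeasure := by
  have : IsFiniteMeasure ((volume : Measure (ℝ × ℝ × ℝ × ℝ)).restrict quatBall) :=
    ⟨by simpa using volume_quatBall_ne_top.lt_top⟩
  exact Measure.isFiniteMeasure_map _ _

/-- Left translation by a rotation lifts to multiplication by a unit quaternion, which preserves
both the volume and the unit ball. -/
instance quatMeasure.instIsMulLeftInvariant : quatMeasure.IsMulLeftInvariant := by
  refine ⟨fun g => ?_⟩
  obtain ⟨w, x, y, z, hN, -, hg⟩ := SO3.exists_eulerMatrix g.2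
  set p : ℝ × ℝ × ℝ × ℝ := (w, z, x, y)
  have hp : quatNormSq p = 1 := hN
  have hgp : (g : Matrix (Fin 3) (Fin 3) ℝ) = quatMatrix p := hg
  have hcomm : ∀ q, q ≠ 0 → g * quatRotation q = quatRotation (quatMul p q) := by
    intro q hq
    have hq' : quatMul p q ≠ 0 := by
      rw [Ne, ← quatNormSq_eq_zero, quatNormSq_quatMul, hp, one_mul, quatNormSq_eq_zero]
      exact hq
    apply Subtype.ext
    rw [Submonoid.coe_mul, quatRotation_coe hq, quatRotation_coe hq', quatMatrix_quatMul,
      quatNormSq_quatMul, hp, one_mul, hgp, Matrix.mul_smul]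
  have hball : quatMul p ⁻¹' quatBall = quatBall := by
    ext q
    simp only [mem_preimage, quatBall, mem_ofPred_eq, quatNormSq_quatMul, hp, one_mul]
  have hmp : MeasurePreserving (quatMul p) (volume.restrict quatBall)
      (volume.restrict quatBall) := by
    have h := (measurePreserving_quatMul hp).restrict_preimage isOpen_quatBall.measurableSet
    rwa [hball] at h
  have : NullSingletonClass (volume : Measure (ℝ × ℝ × ℝ × ℝ)) :=
    Measure.prod.instNullSingletonClass_fst (μ := (volume : Measure ℝ))
      (ν := (volume : Measure (ℝ × ℝ × ℝ)))
  have hae : (fun q => g * quatRotation q) =ᵐ[volume.restrict quatBall]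
      fun q => quatRotation (quatMul p q) := by
    refine ae_restrict_of_ae ?_
    filter_upwards [compl_mem_ae_iff.2 (measure_singleton (μ := volume) (0 : ℝ × ℝ × ℝ × ℝ))]
      with q hq using hcomm q hq
  calc quatMeasure.map (g * ·)
      = (volume.restrict quatBall).map (fun q => g * quatRotation q) := by
        rw [quatMeasure, Measure.map_map (measurable_const_mul g) measurable_quatRotation]
        rfl
    _ = (volume.restrict quatBall).map (fun q => quatRotation (quatMul p q)) :=
        Measure.map_congr hae
    _ = ((volume.restrict quatBall).map (quatMul p)).map quatRotation :=
        (Measure.map_map measurable_quatRotation hmp.measurable).symm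
    _ = quatMeasure := by rw [hmp.map_eq, quatMeasure]

/-- By uniqueness of Haar measure on a compact group. -/
theorem quatMeasure_eq_smul_haarSO3 : quatMeasure = volume quatBall • haarSO3 := by
  have : haarSO3.IsHaarMeasure := Measure.isHaarMeasure_haarMeasure ⊤
  have h := Measure.isMulInvariant_eq_smul_of_compactSpace quatMeasure haarSO3
  have hu : quatMeasure univ = volume quatBall := by
    rw [quatMeasure, Measure.map_apply measurable_quatRotation MeasurableSet.univ, preimage_univ,
      Measure.restrict_apply_univ]
  generalize quatMeasure.haarScalarFactor haarSO3 = c at h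
  rw [h, Measure.smul_apply, measure_univ, ENNReal.smul_def, smul_eq_mul, mul_one] at hu
  rw [← hu, h]
  rfl

/-! ### Spherical coordinates on the quaternions -/

/-- Integration in polar coordinates over a plane set that is a sector up to the origin and the
negative half-axis. -/
theorem setLIntegral_eq_polar {D : Set (ℝ × ℝ)} {S : Set ℝ} (hD : MeasurableSet D)
    (hS : MeasurableSet S) (hSπ : S ⊆ Ioo (-Real.pi) Real.pi)
    (hmem : ∀ r : ℝ, 0 < r → ∀ θ ∈ Ioo (-Real.pi) Real.pi,
      ((r * Real.cos θ, r * Real.sin θ) ∈ D ↔ θ ∈ S))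
    {f : ℝ × ℝ → ENNReal} (hf : Measurable f) :
    ∫⁻ p in D, f p = ∫⁻ r in Ioi 0, ∫⁻ θ in S,
      ENNReal.ofReal r * f (r * Real.cos θ, r * Real.sin θ) := by
  have hT : MeasurableSet polarCoord.target := polarCoord.open_target.measurableSet
  have hI : Ioi 0 ×ˢ S ⊆ polarCoord.target := prod_mono subset_rfl hSπ
  have hpt : ∀ p ∈ polarCoord.target, ENNReal.ofReal p.1 • D.indicator f (polarCoord.symm p) =
      (Ioi 0 ×ˢ S).indicator (fun p : ℝ × ℝ =>
        ENNReal.ofReal p.1 * f (p.1 * Real.cos p.2, p.1 * Real.sin p.2)) p := by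
    rintro ⟨r, θ⟩ ⟨hr, hθ⟩
    have h := hmem r hr θ hθ
    have hs : polarCoord.symm (r, θ) = (r * Real.cos θ, r * Real.sin θ) := rfl
    rw [hs, smul_eq_mul]
    by_cases hd : θ ∈ S
    · rw [indicator_of_mem (h.2 hd), indicator_of_mem (show (r, θ) ∈ Ioi 0 ×ˢ S from ⟨hr, hd⟩)]
    · rw [indicator_of_notMem (mt h.1 hd), indicator_of_notMem (fun hc => hd hc.2), mul_zero]
  rw [← lintegral_indicator hD, ← lintegral_comp_polarCoord_symm, setLIntegral_congr_fun hT hpt,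
    setLIntegral_indicator (measurableSet_Ioi.prod hS), inter_eq_left.2 hI, Measure.volume_eq_prod,
    setLIntegral_prod _ (by fun_prop)]

theorem lintegral_eq_polar {f : ℝ × ℝ → ENNReal} (hf : Measurable f) :
    ∫⁻ p, f p = ∫⁻ r in Ioi 0, ∫⁻ φ in Ioo 0 (2 * Real.pi),
      ENNReal.ofReal r * f (r * Real.cos φ, r * Real.sin φ) := by
  -- the point reflection turns the range `(-π, π)` of the argument into `(0, 2π)`
  have hneg : ∫⁻ p, f p = ∫⁻ p in univ, f (-p) := by
    rw [setLIntegral_univ, lintegral_neg_eq_self]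
  rw [hneg, setLIntegral_eq_polar MeasurableSet.univ measurableSet_Ioo subset_rfl
    (fun r _ θ hθ => iff_of_true (mem_univ _) hθ) (f := fun p => f (-p)) (by fun_prop)]
  refine lintegral_congr fun r => ?_
  have hpre : (fun θ => θ + Real.pi) ⁻¹' Ioo 0 (2 * Real.pi) = Ioo (-Real.pi) Real.pi := by
    rw [preimage_add_const_Ioo]
    congr 1 <;> ring
  rw [← (measurePreserving_add_right volume Real.pi).setLIntegral_comp_preimage
    (s := Ioo 0 (2 * Real.pi)) measurableSet_Ioo (by fun_prop), hpre]
  simp only [Real.cos_add_pi, Real.sin_add_pi, Prod.neg_mk, mul_neg]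

theorem lintegral_eq_spherical {f : ℝ × ℝ × ℝ → ENNReal} (hf : Measurable f) :
    ∫⁻ v, f v = ∫⁻ s in Ioi 0, ∫⁻ ψ in Ioo (-(Real.pi / 2)) (Real.pi / 2),
      ∫⁻ φ in Ioo 0 (2 * Real.pi), ENNReal.ofReal s * (ENNReal.ofReal (s * Real.cos ψ) *
        f (s * Real.sin ψ, s * Real.cos ψ * Real.cos φ, s * Real.cos ψ * Real.sin φ)) := by
  let g : ℝ × ℝ → ENNReal := fun a => ∫⁻ φ in Ioo 0 (2 * Real.pi),
    ENNReal.ofReal a.1 * f (a.2, a.1 * Real.cos φ, a.1 * Real.sin φ)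
  have hg : Measurable g := by
    refine Measurable.lintegral_prod_right' (f := fun b : (ℝ × ℝ) × ℝ => ENNReal.ofReal b.1.1 *
      f (b.1.2, b.1.1 * Real.cos b.2, b.1.1 * Real.sin b.2)) ?_
    fun_prop
  calc ∫⁻ v, f v = ∫⁻ z, ∫⁻ p : ℝ × ℝ, f (z, p) := by
        rw [Measure.volume_eq_prod, lintegral_prod _ hf.aemeasurable]
    _ = ∫⁻ z, ∫⁻ ρ in Ioi 0, g (ρ, z) :=
        lintegral_congr fun z => lintegral_eq_polar (by fun_prop)
    _ = ∫⁻ a in Ioi 0 ×ˢ univ, g a := by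
        rw [Measure.volume_eq_prod, setLIntegral_prod_symm _ hg.aemeasurable, setLIntegral_univ]
    _ = ∫⁻ s in Ioi 0, ∫⁻ ψ in Ioo (-(Real.pi / 2)) (Real.pi / 2),
          ENNReal.ofReal s * g (s * Real.cos ψ, s * Real.sin ψ) := by
        have hpi := Real.pi_pos
        refine setLIntegral_eq_polar (measurableSet_Ioi.prod MeasurableSet.univ) measurableSet_Ioo
          (Ioo_subset_Ioo (by linarith) (by linarith)) (fun r hr θ hθ => ?_) hg
        rw [mem_prod, mem_Ioi, mul_pos_iff_of_pos_left hr, and_iff_left (mem_univ _)]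
        refine ⟨fun h => ?_, Real.cos_pos_of_mem_Ioo⟩
        by_contra hc
        rw [← Real.cos_abs] at h
        refine h.not_ge (Real.cos_nonpos_of_pi_div_two_le_of_le (x := |θ|) ?_ ?_)
        · rw [mem_Ioo, ← abs_lt, not_lt] at hc
          exact hc
        · linarith [abs_lt.2 hθ]
    _ = _ := by
        simp only [g]
        refine lintegral_congr fun s => lintegral_congr fun ψ => ?_
        rw [← lintegral_const_mul _ (by fun_prop)]

/-- Integration over the quaternions with positive real part, in the coordinates
`r (cos (α / 2) + sin (α / 2) n(φ, ψ))`. The Jacobian is the product of `1 / 2`, from halving `α`,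
and of the three radii of the successive passages to plane polar coordinates. -/
theorem setLIntegral_quat_eq {F : ℝ × ℝ × ℝ × ℝ → ENNReal} (hF : Measurable F) :
    ∫⁻ w in Ioi 0, ∫⁻ v, F (w, v) =
      ∫⁻ r in Ioi 0, ∫⁻ α in Ioo 0 Real.pi, ∫⁻ ψ in Ioo (-(Real.pi / 2)) (Real.pi / 2),
        ∫⁻ φ in Ioo 0 (2 * Real.pi), ENNReal.ofReal (1 / 2) * (ENNReal.ofReal r *
          (ENNReal.ofReal (r * Real.sin (α / 2)) *
            (ENNReal.ofReal (r * Real.sin (α / 2) * Real.cos ψ) *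
              F (r * Real.cos (α / 2), r * Real.sin (α / 2) * Real.sin ψ,
                r * Real.sin (α / 2) * Real.cos ψ * Real.cos φ,
                r * Real.sin (α / 2) * Real.cos ψ * Real.sin φ)))) := by
  let g : ℝ × ℝ → ENNReal := fun a => ∫⁻ ψ in Ioo (-(Real.pi / 2)) (Real.pi / 2),
    ∫⁻ φ in Ioo 0 (2 * Real.pi), ENNReal.ofReal a.2 * (ENNReal.ofReal (a.2 * Real.cos ψ) *
      F (a.1, a.2 * Real.sin ψ, a.2 * Real.cos ψ * Real.cos φ, a.2 * Real.cos ψ * Real.sin φ))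
  have hg : Measurable g := by
    refine Measurable.lintegral_prod_right' (f := fun b : (ℝ × ℝ) × ℝ =>
      ∫⁻ φ in Ioo 0 (2 * Real.pi), ENNReal.ofReal b.1.2 *
        (ENNReal.ofReal (b.1.2 * Real.cos b.2) * F (b.1.1, b.1.2 * Real.sin b.2,
          b.1.2 * Real.cos b.2 * Real.cos φ, b.1.2 * Real.cos b.2 * Real.sin φ))) ?_
    refine Measurable.lintegral_prod_right' (f := fun c : ((ℝ × ℝ) × ℝ) × ℝ =>
      ENNReal.ofReal c.1.1.2 * (ENNReal.ofReal (c.1.1.2 * Real.cos c.1.2) *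
        F (c.1.1.1, c.1.1.2 * Real.sin c.1.2, c.1.1.2 * Real.cos c.1.2 * Real.cos c.2,
          c.1.1.2 * Real.cos c.1.2 * Real.sin c.2))) ?_
    fun_prop
  have hpi := Real.pi_pos
  calc ∫⁻ w in Ioi 0, ∫⁻ v, F (w, v) = ∫⁻ w in Ioi 0, ∫⁻ s in Ioi 0, g (w, s) :=
        lintegral_congr fun w => lintegral_eq_spherical (by fun_prop)
    _ = ∫⁻ a in Ioi 0 ×ˢ Ioi 0, g a := by
        rw [Measure.volume_eq_prod, setLIntegral_prod _ hg.aemeasurable]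
    _ = ∫⁻ r in Ioi 0, ∫⁻ β in Ioo 0 (Real.pi / 2),
          ENNReal.ofReal r * g (r * Real.cos β, r * Real.sin β) := by
        refine setLIntegral_eq_polar (measurableSet_Ioi.prod measurableSet_Ioi) measurableSet_Ioo
          (Ioo_subset_Ioo (by linarith) (by linarith)) (fun r hr θ hθ => ?_) hg
        rw [mem_prod, mem_Ioi, mem_Ioi, mul_pos_iff_of_pos_left hr, mul_pos_iff_of_pos_left hr]
        refine ⟨fun ⟨hc, hs⟩ => ?_, fun h => ⟨Real.cos_pos_of_mem_Ioo ⟨by linarith [h.1], h.2⟩,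
          Real.sin_pos_of_pos_of_lt_pi h.1 (by linarith [h.2])⟩⟩
        have h0 : 0 < θ := by
          by_contra h
          exact hs.not_ge (Real.sin_nonpos_of_nonpos_of_neg_pi_le (not_lt.1 h) hθ.1.le)
        refine ⟨h0, ?_⟩
        by_contra h
        exact hc.not_ge (Real.cos_nonpos_of_pi_div_two_le_of_le (not_lt.1 h) (by linarith [hθ.2]))
    _ = ∫⁻ r in Ioi 0, ∫⁻ α in Ioo 0 Real.pi, ENNReal.ofReal (1 / 2) *
          (ENNReal.ofReal r * g (r * Real.cos (α / 2), r * Real.sin (α / 2))) := by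
        refine lintegral_congr fun r => ?_
        have him : (fun α : ℝ => α / 2) '' Ioo 0 Real.pi = Ioo 0 (Real.pi / 2) := by
          have h := image_mul_right_Ioo 0 Real.pi (show (0 : ℝ) < 2⁻¹ by norm_num)
          simpa only [← div_eq_mul_inv, zero_div] using h
        rw [← him, lintegral_image_eq_lintegral_abs_deriv_mul measurableSet_Ioo
          (f' := fun _ => 1 / 2)
          (fun x _ => ((hasDerivAt_id' x).div_const 2).hasDerivWithinAt)
          (fun x _ y _ h => by simpa using h)]
        simp only [abs_of_pos (one_half_pos (α := ℝ))]
    _ = _ := by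
        simp only [g]
        refine lintegral_congr fun r => lintegral_congr fun α => ?_
        rw [← lintegral_const_mul' _ _ ENNReal.ofReal_ne_top,
          ← lintegral_const_mul' _ _ ENNReal.ofReal_ne_top]
        refine lintegral_congr fun ψ => ?_
        rw [← lintegral_const_mul' _ _ ENNReal.ofReal_ne_top,
          ← lintegral_const_mul' _ _ ENNReal.ofReal_ne_top]

theorem lintegral_quat_of_even {F : ℝ × ℝ × ℝ × ℝ → ENNReal} (hF : Measurable F)
    (heven : ∀ q, F (-q) = F q) : ∫⁻ q, F q = 2 * ∫⁻ w in Ioi 0, ∫⁻ v, F (w, v) := by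
  rw [Measure.volume_eq_prod, lintegral_prod _ hF.aemeasurable]
  have hg : Measurable fun w => ∫⁻ v, F (w, v) := hF.lintegral_prod_right'
  have hgneg : ∀ w, ∫⁻ v, F (-w, v) = ∫⁻ v, F (w, v) := fun w => by
    rw [← lintegral_neg_eq_self (fun v => F (-w, v))]
    exact lintegral_congr fun v => heven (w, v)
  have hpre : (fun w : ℝ => -w) ⁻¹' Iio 0 = Ioi 0 := by simp
  have hneg : ∫⁻ w in Iic 0, ∫⁻ v, F (w, v) = ∫⁻ w in Ioi 0, ∫⁻ v, F (w, v) := by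
    rw [← setLIntegral_congr Iio_ae_eq_Iic,
      ← (Measure.measurePreserving_neg volume).setLIntegral_comp_preimage measurableSet_Iio hg,
      hpre]
    exact lintegral_congr hgneg
  rw [← lintegral_add_compl _ (measurableSet_Ioi (a := (0 : ℝ))), compl_Ioi, hneg, two_mul]

/-! ### Identification of the Haar measure -/

theorem continuous_polarDensity : Continuous polarDensity := by
  unfold polarDensity; fun_prop

theorem polarDensity_nonneg {u : ℝ × ℝ × ℝ} (hu : u ∈ polarDomain) : 0 ≤ polarDensity u := by
  have hc : 0 ≤ Real.cos u.2.1 := Real.cos_nonneg_of_mem_Icc hu.2.1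
  unfold polarDensity
  positivity

theorem polarDomain_ae_eq_interior : (polarDomain : Set (ℝ × ℝ × ℝ)) =ᵐ[volume]
    interior polarDomain := by
  rw [interior_polarDomain, polarDomain]
  exact Measure.set_prod_ae_eq Ioo_ae_eq_Ico.symm
    (Measure.set_prod_ae_eq Ioo_ae_eq_Icc.symm Ioo_ae_eq_Icc.symm)

theorem measurableSet_polarDomain : MeasurableSet polarDomain :=
  measurableSet_Ico.prod (measurableSet_Icc.prod measurableSet_Icc)

/-- The probability measure with density `polarDensity` on the domain of the polar chart. -/
noncomputable def polarMeasure : Measure (ℝ × ℝ × ℝ) :=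
  (volume.restrict polarDomain).withDensity fun u => ENNReal.ofReal (polarDensity u)

theorem polarMeasure_apply {s : Set (ℝ × ℝ × ℝ)} (hs : MeasurableSet s) :
    polarMeasure s = ∫⁻ u in s ∩ polarDomain, ENNReal.ofReal (polarDensity u) := by
  rw [polarMeasure, withDensity_apply _ hs, Measure.restrict_restrict hs]

theorem polarMeasure_univ : polarMeasure univ = 1 := by
  have hcos : ∫ ψ in Icc (-(Real.pi / 2)) (Real.pi / 2), Real.cos ψ = 2 := by
    rw [integral_Icc_eq_integral_Ioc,
      ← intervalIntegral.integral_of_le (by linarith [Real.pi_pos]), integral_cos]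
    norm_num
  have hsin : ∫ α in Icc 0 Real.pi, Real.sin (α / 2) ^ 2 = Real.pi / 2 := by
    rw [integral_Icc_eq_integral_Ioc, ← intervalIntegral.integral_of_le Real.pi_pos.le,
      intervalIntegral.integral_comp_div (fun x => Real.sin x ^ 2) two_ne_zero, integral_sin_sq]
    simp
    ring
  have hint : ∫ u in polarDomain, polarDensity u = 1 := by
    have h1 := setIntegral_prod_mul (μ := volume) (ν := volume)
      (fun _ : ℝ => 1 / (2 * Real.pi ^ 2))
      (fun v : ℝ × ℝ => Real.cos v.1 * Real.sin (v.2 / 2) ^ 2) (Ico 0 (2 * Real.pi))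
      (Icc (-(Real.pi / 2)) (Real.pi / 2) ×ˢ Icc 0 Real.pi)
    have h2 := setIntegral_prod_mul (μ := volume) (ν := volume) Real.cos
      (fun α => Real.sin (α / 2) ^ 2) (Icc (-(Real.pi / 2)) (Real.pi / 2)) (Icc 0 Real.pi)
    rw [← Measure.volume_eq_prod] at h1 h2
    rw [h2, hcos, hsin] at h1
    simp only [polarDensity, polarDomain, mul_assoc] at h1 ⊢
    rw [h1]
    simp [Real.pi_pos.le]
    have := Real.pi_ne_zero
    field_simp
  have hI : IntegrableOn polarDensity polarDomain := by
    refine (continuous_polarDensity.continuousOn.integrableOn_compact (K :=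
      Icc 0 (2 * Real.pi) ×ˢ (Icc (-(Real.pi / 2)) (Real.pi / 2) ×ˢ Icc 0 Real.pi))
      (isCompact_Icc.prod (isCompact_Icc.prod isCompact_Icc))).mono_set ?_
    exact prod_mono Ico_subset_Icc_self subset_rfl
  rw [polarMeasure_apply MeasurableSet.univ, univ_inter, ← ofReal_integral_eq_lintegral_ofReal hI
    ((ae_restrict_iff' measurableSet_polarDomain).2 (ae_of_all _ fun u => polarDensity_nonneg)),
    hint, ENNReal.ofReal_one]

theorem quatNormSq_polar (r φ ψ α : ℝ) :
    quatNormSq (r * Real.cos (α / 2), r * Real.sin (α / 2) * Real.sin ψ,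
      r * Real.sin (α / 2) * Real.cos ψ * Real.cos φ,
      r * Real.sin (α / 2) * Real.cos ψ * Real.sin φ) = r ^ 2 := by
  simp only [quatNormSq]
  linear_combination (r * Real.sin (α / 2) * Real.cos ψ) ^ 2 * Real.sin_sq_add_cos_sq φ +
    (r * Real.sin (α / 2)) ^ 2 * Real.sin_sq_add_cos_sq ψ + r ^ 2 * Real.sin_sq_add_cos_sq (α / 2)

/-- Every positive multiple of the quaternion `cos (α / 2) + sin (α / 2) n(φ, ψ)` represents the
rotation with polar coordinates `(φ, ψ, α)`. -/
theorem quatRotation_polar {r : ℝ} (hr : 0 < r) (φ ψ α : ℝ) :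
    quatRotation (r * Real.cos (α / 2), r * Real.sin (α / 2) * Real.sin ψ,
      r * Real.sin (α / 2) * Real.cos ψ * Real.cos φ,
      r * Real.sin (α / 2) * Real.cos ψ * Real.sin φ) = polarChart (φ, ψ, α) := by
  have hN := quatNormSq_polar r φ ψ α
  apply Subtype.ext
  rw [quatRotation_coe, hN, polarChart_eq_eulerMatrix, quatMatrix]
  · simp only [mul_assoc]
    rw [eulerMatrix_smul, inv_smul_smul₀ (pow_pos hr 2).ne']
  · rw [Ne, ← quatNormSq_eq_zero, hN]
    exact (pow_pos hr 2).ne'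

theorem quatRotation_neg (q : ℝ × ℝ × ℝ × ℝ) : quatRotation (-q) = quatRotation q := by
  by_cases hq : q = 0
  · rw [hq, neg_zero]
  apply Subtype.ext
  rw [quatRotation_coe hq, quatRotation_coe (neg_ne_zero.2 hq), quatMatrix, quatMatrix,
    ← eulerMatrix_neg q.1]
  simp [quatNormSq]

/-- In spherical coordinates the quaternions of the unit ball over a set of rotations form a product
of a radial factor, which integrates to a constant, and of the polar coordinates of that set. -/
theorem exists_quatMeasure_eq_smul :
    ∃ c : ENNReal, ∀ B : Set SO3, MeasurableSet B →
      quatMeasure B = c * polarMeasure.map polarChart B := by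
  classical
  refine ⟨2 * ∫⁻ r in Ioi 0, ENNReal.ofReal (Real.pi ^ 2 * r ^ 3) * (Iio 1).indicator 1 r,
    fun B hB => ?_⟩
  have hS : MeasurableSet (quatRotation ⁻¹' B ∩ quatBall) :=
    (measurable_quatRotation hB).inter isOpen_quatBall.measurableSet
  let F : ℝ × ℝ × ℝ × ℝ → ENNReal := (quatRotation ⁻¹' B ∩ quatBall).indicator 1
  have hF : Measurable F := measurable_one.indicator hS
  have heven : ∀ q, F (-q) = F q := fun q => by
    have hN : quatNormSq (-q) = quatNormSq q := by simp [quatNormSq]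
    simp only [F, indicator_apply, mem_inter_iff, mem_preimage, quatRotation_neg, quatBall,
      mem_ofPred_eq, hN, Pi.one_apply]
  let G : ℝ × ℝ × ℝ → ENNReal := fun u =>
    ENNReal.ofReal (polarDensity u) * B.indicator 1 (polarChart u)
  have hG : Measurable G := continuous_polarDensity.measurable.ennreal_ofReal.mul
    ((measurable_one.indicator hB).comp continuous_polarChart.measurable)
  have hFG : ∀ r ∈ Ioi (0 : ℝ), ∀ α ∈ Ioo 0 Real.pi,
      ∀ ψ ∈ Ioo (-(Real.pi / 2)) (Real.pi / 2), ∀ φ : ℝ,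
      ENNReal.ofReal (1 / 2) * (ENNReal.ofReal r * (ENNReal.ofReal (r * Real.sin (α / 2)) *
        (ENNReal.ofReal (r * Real.sin (α / 2) * Real.cos ψ) *
          F (r * Real.cos (α / 2), r * Real.sin (α / 2) * Real.sin ψ,
            r * Real.sin (α / 2) * Real.cos ψ * Real.cos φ,
            r * Real.sin (α / 2) * Real.cos ψ * Real.sin φ)))) =
      ENNReal.ofReal (Real.pi ^ 2 * r ^ 3) * (Iio 1).indicator 1 r * G (φ, ψ, α) := by
    intro r hr α hα ψ hψ φ
    have hr' : (0 : ℝ) < r := hr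
    have hs : 0 < Real.sin (α / 2) :=
      Real.sin_pos_of_pos_of_lt_pi (by linarith [hα.1]) (by linarith [hα.1, hα.2])
    have hc : 0 < Real.cos ψ := Real.cos_pos_of_mem_Ioo hψ
    have hFr : F (r * Real.cos (α / 2), r * Real.sin (α / 2) * Real.sin ψ,
        r * Real.sin (α / 2) * Real.cos ψ * Real.cos φ,
        r * Real.sin (α / 2) * Real.cos ψ * Real.sin φ) =
        (Iio 1).indicator 1 r * B.indicator 1 (polarChart (φ, ψ, α)) := by
      have hr1 : r ^ 2 < 1 ↔ r < 1 := by
        rw [sq_lt_one_iff_abs_lt_one, abs_of_pos hr']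
      simp only [F, indicator_apply, mem_inter_iff, mem_preimage, quatRotation_polar hr', quatBall,
        mem_ofPred_eq, quatNormSq_polar, hr1, mem_Iio, Pi.one_apply]
      split_ifs <;> simp_all
    have hreal : ENNReal.ofReal (1 / 2) * (ENNReal.ofReal r *
        (ENNReal.ofReal (r * Real.sin (α / 2)) *
          ENNReal.ofReal (r * Real.sin (α / 2) * Real.cos ψ))) =
        ENNReal.ofReal (Real.pi ^ 2 * r ^ 3) * ENNReal.ofReal (polarDensity (φ, ψ, α)) := by
      rw [← ENNReal.ofReal_mul (by positivity), ← ENNReal.ofReal_mul (by positivity),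
        ← ENNReal.ofReal_mul (by positivity), ← ENNReal.ofReal_mul (by positivity)]
      congr 1
      have := Real.pi_ne_zero
      simp only [polarDensity]
      field_simp
    simp only [G]
    rw [hFr]
    calc _ = ENNReal.ofReal (1 / 2) * (ENNReal.ofReal r * (ENNReal.ofReal (r * Real.sin (α / 2)) *
          ENNReal.ofReal (r * Real.sin (α / 2) * Real.cos ψ))) *
          ((Iio 1).indicator 1 r * B.indicator 1 (polarChart (φ, ψ, α))) := by ring
      _ = _ := by rw [hreal]; ring
  have hpolar : polarMeasure.map polarChart B = ∫⁻ α in Ioo 0 Real.pi,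
      ∫⁻ ψ in Ioo (-(Real.pi / 2)) (Real.pi / 2), ∫⁻ φ in Ioo 0 (2 * Real.pi), G (φ, ψ, α) := by
    have hpB := continuous_polarChart.measurable hB
    have hG' : Measurable fun v : ℝ × ℝ => ∫⁻ φ in Ioo 0 (2 * Real.pi), G (φ, v) :=
      hG.lintegral_prod_left'
    calc polarMeasure.map polarChart B
        = ∫⁻ u in polarDomain, (polarChart ⁻¹' B).indicator
            (fun u => ENNReal.ofReal (polarDensity u)) u := by
          rw [Measure.map_apply continuous_polarChart.measurable hB, polarMeasure_apply hpB,
            setLIntegral_indicator hpB]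
      _ = ∫⁻ u in polarDomain, G u := by
          refine lintegral_congr fun u => ?_
          simp only [G, indicator_apply, mem_preimage, Pi.one_apply]
          split_ifs <;> simp
      _ = ∫⁻ u in Ioo 0 (2 * Real.pi) ×ˢ
            (Ioo (-(Real.pi / 2)) (Real.pi / 2) ×ˢ Ioo 0 Real.pi), G u := by
          rw [setLIntegral_congr polarDomain_ae_eq_interior, interior_polarDomain]
      _ = _ := by
          rw [Measure.volume_eq_prod, setLIntegral_prod_symm _ hG.aemeasurable,
            Measure.volume_eq_prod, setLIntegral_prod_symm _ hG'.aemeasurable]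
  have hfin : ∀ r : ℝ, ENNReal.ofReal (Real.pi ^ 2 * r ^ 3) * (Iio 1).indicator 1 r ≠ ⊤ := by
    intro r
    refine ENNReal.mul_ne_top ENNReal.ofReal_ne_top ?_
    rw [indicator_apply]
    split_ifs <;> simp
  calc quatMeasure B = ∫⁻ q, F q := by
        rw [quatMeasure, Measure.map_apply measurable_quatRotation hB,
          Measure.restrict_apply (measurable_quatRotation hB), lintegral_indicator_one hS]
    _ = 2 * ∫⁻ w in Ioi 0, ∫⁻ v, F (w, v) := lintegral_quat_of_even hF heven
    _ = 2 * ∫⁻ r in Ioi 0, ENNReal.ofReal (Real.pi ^ 2 * r ^ 3) * (Iio 1).indicator 1 r *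
          polarMeasure.map polarChart B := by
        rw [setLIntegral_quat_eq hF, hpolar]
        congr 1
        refine setLIntegral_congr_fun measurableSet_Ioi fun r hr => ?_
        rw [← lintegral_const_mul' _ _ (hfin r)]
        refine setLIntegral_congr_fun measurableSet_Ioo fun α hα => ?_
        rw [← lintegral_const_mul' _ _ (hfin r)]
        refine setLIntegral_congr_fun measurableSet_Ioo fun ψ hψ => ?_
        rw [← lintegral_const_mul' _ _ (hfin r)]
        exact lintegral_congr fun φ => hFG r hr α hα ψ hψ φ
    _ = _ := by
        rw [lintegral_mul_const, mul_assoc]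
        exact Measurable.mul (by fun_prop) (measurable_one.indicator measurableSet_Iio)

/-- The Haar measure and the image of the polar measure are both proportional to `quatMeasure`, and
both have total mass one. -/
theorem map_polarMeasure_eq_haarSO3 : polarMeasure.map polarChart = haarSO3 := by
  obtain ⟨c, hc⟩ := exists_quatMeasure_eq_smul
  have huniv : polarMeasure.map polarChart univ = 1 := by
    rw [Measure.map_apply continuous_polarChart.measurable MeasurableSet.univ, preimage_univ,
      polarMeasure_univ]
  have hcvol : c = volume quatBall := by
    have h := hc univ MeasurableSet.univ
    rw [huniv, mul_one, quatMeasure_eq_smul_haarSO3, Measure.smul_apply, measure_univ, smul_eq_mul,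
      mul_one] at h
    exact h.symm
  refine Measure.ext fun B hB => ?_
  have h := hc B hB
  rw [hcvol, quatMeasure_eq_smul_haarSO3, Measure.smul_apply, smul_eq_mul] at h
  exact ((ENNReal.mul_right_inj volume_quatBall_ne_zero volume_quatBall_ne_top).1 h).symm

/-- Up to sets that are null for both measures, `A` lies in the interior of the domain, where it is
the full preimage of its image. -/
theorem haarSO3_polarChart_image {A : Set (ℝ × ℝ × ℝ)} (hA : MeasurableSet A)
    (hAU : A ⊆ polarDomain) :
    haarSO3 (polarChart '' A) = ∫⁻ u in A, ENNReal.ofReal (polarDensity u) := by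
  have hmeas : ∀ s : Set (ℝ × ℝ × ℝ), MeasurableSet s → s ⊆ interior polarDomain →
      MeasurableSet (polarChart '' s) := fun s hs hsU =>
    hs.image_of_continuousOn_injOn continuous_polarChart.continuousOn
      (polarChart_injOn_interior.mono hsU)
  have hpre : ∀ s : Set (ℝ × ℝ × ℝ), s ⊆ interior polarDomain →
      polarChart ⁻¹' (polarChart '' s) ∩ polarDomain = s := fun s hsU => by
    refine Subset.antisymm ?_ fun u hu => ⟨mem_image_of_mem _ hu, interior_subset (hsU hu)⟩
    rintro u ⟨⟨v, hv, hvu⟩, hu⟩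
    rwa [← polarChart_eq_of_mem_interior (hsU hv) hu hvu]
  have himage : ∀ s : Set (ℝ × ℝ × ℝ), MeasurableSet s → s ⊆ interior polarDomain →
      haarSO3 (polarChart '' s) = ∫⁻ u in s, ENNReal.ofReal (polarDensity u) := by
    intro s hs hsU
    rw [← map_polarMeasure_eq_haarSO3, Measure.map_apply continuous_polarChart.measurable
      (hmeas s hs hsU), polarMeasure_apply (continuous_polarChart.measurable (hmeas s hs hsU)),
      hpre s hsU]
  have hnull : haarSO3 (polarChart '' interior polarDomain)ᶜ = 0 := by
    rw [prob_compl_eq_zero_iff (hmeas _ isOpen_interior.measurableSet subset_rfl),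
      himage _ isOpen_interior.measurableSet subset_rfl,
      ← setLIntegral_congr polarDomain_ae_eq_interior, ← univ_inter polarDomain,
      ← polarMeasure_apply MeasurableSet.univ, polarMeasure_univ]
  have hAi : (A ∩ interior polarDomain : Set (ℝ × ℝ × ℝ)) =ᵐ[volume] A := by
    have h := (ae_eq_refl A).inter polarDomain_ae_eq_interior
    rw [inter_eq_left.2 hAU] at h
    exact h.symm
  have hsub : polarChart '' A ⊆
      polarChart '' (A ∩ interior polarDomain) ∪ (polarChart '' interior polarDomain)ᶜ := by
    rintro _ ⟨u, hu, rfl⟩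
    by_cases h : polarChart u ∈ polarChart '' interior polarDomain
    · obtain ⟨v, hv, hvu⟩ := h
      obtain rfl := polarChart_eq_of_mem_interior hv (hAU hu) hvu
      exact Or.inl ⟨v, ⟨hu, hv⟩, rfl⟩
    · exact Or.inr h
  rw [← setLIntegral_congr hAi,
    ← himage _ (hA.inter isOpen_interior.measurableSet) inter_subset_right]
  refine le_antisymm ?_ (measure_mono (image_mono inter_subset_left))
  refine (measure_mono hsub).trans ((measure_union_le _ _).trans ?_)
  rw [hnull, add_zero]

theorem mainTheorem2 :
    -- the Rodrigues formula, for every unit axis and every angle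
    (∀ n : Fin 3 → ℝ, n 0 ^ 2 + n 1 ^ 2 + n 2 ^ 2 = 1 → ∀ α : ℝ,
      axisRotation n α = 1 + Real.sin α • skewMatrix n + (1 - Real.cos α) • skewMatrix n ^ 2) ∧
    -- the rotation in the chart, in spherical coordinates
    (∀ φ ψ α : ℝ,
      (polarChart (φ, ψ, α) : Matrix (Fin 3) (Fin 3) ℝ) =
        1 + Real.sin α • skewMatrix (sphericalAxis φ ψ) +
          (1 - Real.cos α) • skewMatrix (sphericalAxis φ ψ) ^ 2) ∧
    -- `p` parametrises the whole of `SO(3)`, injectively on the interior of `U`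
    polarChart '' polarDomain = univ ∧
    InjOn polarChart (interior polarDomain) ∧
    -- the pull-back of the Haar probability measure by `p` has density `k` on `U`
    (∀ A : Set (ℝ × ℝ × ℝ), MeasurableSet A → A ⊆ polarDomain →
      haarSO3 (polarChart '' A) = ∫⁻ u in A, ENNReal.ofReal (polarDensity u)) ∧
    -- and the Haar probability measure is the image by `p` of that measure on `U`
    Measure.map polarChart
      ((volume.restrict polarDomain).withDensity fun u => ENNReal.ofReal (polarDensity u)) =
        haarSO3 :=
  ⟨axisRotation_eq_rodrigues, polarChart_eq_rodrigues, polarChart_image_polarDomain,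
    polarChart_injOn_interior, fun _ hA hAU => haarSO3_polarChart_image hA hAU,
    map_polarMeasure_eq_haarSO3⟩
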